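/- Let $\mathbb K$ be an infinite field, let $A$ be a (left and right) noetherian unital associative $\mathbb K$-algebra, and let the torus $T=(\mathbb K^{\times})^{r}$, $r\ge 0$, act rationally on $A$ by $\mathbb K$-algebra automorphisms; that is, $A$ is the directed union of finite-dimensional $T$-invariant subspaces $V$ for which $T\to GL(V)$ is a morphism of algebraic groups. All ideals are two-sided. A $T$-prime ideal of $A$ is a proper $T$-invariant ideal $P$ such that $JL\subseteq P$ implies $J\subseteq P$ or $L\subseteq P$ for all $T$-invariant ideals $J,L$; $T\text{-}\mathrm{Spec}\,A$ is the set of $T$-prime ideals. (In particular every $T$-invariant prime ideal is $T$-prime.) Assume that $T\text{-}\mathrm{Spec}\,A$ is $T$-normally separated: for all $T$-prime ideals $I\subsetneq I'$ there is $u\in I'\setminus I$ whose image $\bar u$ in $A/I$ is a $T$-eigenvector and satisfies, for some $g\in T$, $\bar u\,\bar a=\overline{(g\cdot a)}\,\bar u$ for all $a\in A$. Then for every pair of $T$-prime ideals $I\subsetneq I'$ of $A$ there is a finite chain of ideals $$I=P_0\subsetneq P_1\subsetneq\dots\subsetneq P_n=I'$$ such that all $P_0,\dots,P_n$ are $T$-invariant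 prime ideals and, for each $i<n$, no prime ideal $Q$ of $A$ (whether $T$-invariant or not) satisfies $P_i\subsetneq Q\subsetneq P_{i+1}$. -/

import Mathlib

namespace TorusSpec

/-- A function on the torus `(Kˣ)ʳ` is regular if it is given by a Laurent polynomial
`∑ m, c m * t₁ ^ m₁ ⋯ tᵣ ^ mᵣ` (a finite sum over exponents `m ∈ ℤʳ`). -/
def IsRegularFunction {K : Type*} [Field K] {r : ℕ} (φ : (Fin r → Kˣ) → K) : Prop :=
  ∃ c : (Fin r → ℤ) →₀ K, ∀ t : Fin r → Kˣ,
    φ t = c.sum fun m k => k * ∏ i, ((t i ^ m i : Kˣ) : K)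

/-- An action of the torus `(Kˣ)ʳ` on the `K`-algebra `A` by algebra automorphisms is rational if
`A` is the union of finite-dimensional invariant subspaces `V` for which the representation
`(Kˣ)ʳ → GL(V)` is a morphism of algebraic groups, i.e. all its matrix coefficients
`t ↦ f (t • v)` are regular functions. (Every linear functional on `V` is the restriction of one
on `A`; a sum of two such subspaces is again such a subspace, so the union is directed.) -/
def IsRationalAction {K A : Type*} [Field K] [Ring A] [Algebra K A] {r : ℕ}
    (ρ : (Fin r → Kˣ) →* (A ≃ₐ[K] A)) : Prop :=
  ∀ a : A, ∃ V : Submodule K A, a ∈ V ∧ FiniteDimensional K V ∧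
    (∀ t, ∀ v ∈ V, ρ t v ∈ V) ∧
    ∀ v ∈ V, ∀ f : Module.Dual K A, IsRegularFunction fun t => f (ρ t v)

/-- Prime ideals of a (noncommutative) ring: proper two-sided ideals `P` such that, for two-sided
ideals `J` and `L`, `J * L ⊆ P` implies `J ⊆ P` or `L ⊆ P`. -/
def IsPrime {A : Type*} [Ring A] (P : TwoSidedIdeal A) : Prop :=
  P ≠ ⊤ ∧ ∀ J L : TwoSidedIdeal A, (∀ a ∈ J, ∀ b ∈ L, a * b ∈ P) → J ≤ P ∨ L ≤ P

/-- Two-sided ideals that are stable under a group of algebra automorphisms. -/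
def IsInvariant {K A G : Type*} [Field K] [Ring A] [Algebra K A] [Group G]
    (ρ : G →* (A ≃ₐ[K] A)) (P : TwoSidedIdeal A) : Prop :=
  ∀ g : G, ∀ a ∈ P, ρ g a ∈ P

/-- `G`-prime ideals: proper `G`-stable ideals `P` such that, for `G`-stable ideals `J` and `L`,
`J * L ⊆ P` implies `J ⊆ P` or `L ⊆ P`. The set of these ideals is `G`-Spec `A`. -/
def IsGPrime {K A G : Type*} [Field K] [Ring A] [Algebra K A] [Group G]
    (ρ : G →* (A ≃ₐ[K] A)) (P : TwoSidedIdeal A) : Prop :=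
  IsInvariant ρ P ∧ P ≠ ⊤ ∧
    ∀ J L : TwoSidedIdeal A, IsInvariant ρ J → IsInvariant ρ L →
      (∀ a ∈ J, ∀ b ∈ L, a * b ∈ P) → J ≤ P ∨ L ≤ P

/-- `u` is `G`-normal modulo the `G`-stable ideal `I`: the image of `u` in `A / I` is a
`G`-eigenvector and, for some `g : G`, `u * a = (g • a) * u` in `A / I` for all `a`.
(That the image of `u` is nonzero is imposed where the notion is used.) -/
def IsGNormalMod {K A G : Type*} [Field K] [Ring A] [Algebra K A] [Group G]
    (ρ : G →* (A ≃ₐ[K] A)) (I : TwoSidedIdeal A) (u : A) : Prop :=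
  (∃ χ : G → K, ∀ g, ρ g u - χ g • u ∈ I) ∧ ∃ g : G, ∀ a : A, u * a - ρ g a * u ∈ I

/-- `G`-Spec `A` is `G`-normally separated: for all `G`-primes `I ⊊ I'` there is `u ∈ I' \ I` that
is `G`-normal modulo `I`. -/
def IsGNormallySeparated {K A G : Type*} [Field K] [Ring A] [Algebra K A] [Group G]
    (ρ : G →* (A ≃ₐ[K] A)) : Prop :=
  ∀ I I' : TwoSidedIdeal A, IsGPrime ρ I → IsGPrime ρ I' → I < I' →
    ∃ u ∈ I', u ∉ I ∧ IsGNormalMod ρ I u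

end TorusSpec

/-! A torus over an infinite field is irreducible, so the largest invariant ideal inside a prime is
prime (`IsRationalAction.isPrime_invariantCore`). Since every `T`-prime is such a core
(`IsGPrime.exists_isPrime`), `T`-primes are prime. Given `I < I'`, take a normal `u` from the
separation hypothesis and a prime `P ≤ I'` minimal over `I` and `u`. The core of `P` is a prime
still containing `I` and `u`, so `P` is invariant. A principal ideal theorem for normal elements
leaves no prime strictly between `I` and `P`, and noetherian induction continues the chain from `P`.

The principal ideal theorem rests on an additive rank `rk P` of subquotients of `R`, counting pieces
isomorphic to nonzero left ideals of `R / P`. It is finite on `R / P` (`ElemPrime.rk_ne_top`) and,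
for `P` minimal over a normal `x`, on `R / Rx` (`rk_span_singleton_ne_top`). If `0 ≠ Q < P` and `c ∈
Q` is regular, then `R / (Rx ^ m + Rc)` has rank at least `m`, yet these ranks stabilise by the
ascending chain condition. -/

namespace TorusSpec

/-! ### Rank of subquotients relative to a two-sided ideal -/

section Rank

variable {R : Type*} [Ring R] (P : TwoSidedIdeal R)

/-- The subquotient `B / A` of left ideals has a subquotient isomorphic to a nonzero left ideal
of `R / P`. -/
def Step (A B : Ideal R) : Prop :=
  ∃ C : Ideal R, A ≤ C ∧ ∃ m ∈ B, ∃ w, w ∉ P ∧ ∀ r, r * m ∈ C ↔ r * w ∈ P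

/-- There is a chain of left ideals from `A` to `B` with `n` steps. -/
def HasChain : ℕ → Ideal R → Ideal R → Prop
  | 0, A, B => A ≤ B
  | n + 1, A, B => ∃ D, HasChain n A D ∧ D ≤ B ∧ Step P D B

variable {P}

theorem Step.mono {A A' B B' : Ideal R} (h : Step P A B) (hA : A' ≤ A) (hB : B ≤ B') :
    Step P A' B' := by
  obtain ⟨C, hC, m, hm, w, hw, H⟩ := h
  exact ⟨C, hA.trans hC, m, hB hm, w, hw, H⟩

theorem Step.not_le {A B : Ideal R} (h : Step P A B) : ¬ B ≤ A := by
  obtain ⟨C, hC, m, hm, w, hw, H⟩ := h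
  intro hBA
  have := (H 1).1 (by simpa using hC (hBA hm))
  exact hw (by simpa using this)

theorem HasChain.le {n : ℕ} {A B : Ideal R} (h : HasChain P n A B) : A ≤ B := by
  induction n generalizing B with
  | zero => exact h
  | succ n ih =>
    obtain ⟨D, hD, hDB, -⟩ := h
    exact (ih hD).trans hDB

theorem HasChain.mono_right {n : ℕ} {A B B' : Ideal R} (h : HasChain P n A B) (hB : B ≤ B') :
    HasChain P n A B' := by
  cases n with
  | zero => exact le_trans h hB
  | succ n =>
    obtain ⟨D, hD, hDB, hs⟩ := h
    exact ⟨D, hD, hDB.trans hB, hs.mono le_rfl hB⟩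

theorem HasChain.mono_left {n : ℕ} {A A' B : Ideal R} (h : HasChain P n A B) (hA : A' ≤ A) :
    HasChain P n A' B := by
  induction n generalizing B with
  | zero => exact hA.trans h
  | succ n ih =>
    obtain ⟨D, hD, hDB, hs⟩ := h
    exact ⟨D, ih hD, hDB, hs⟩

theorem HasChain.trans {i j : ℕ} {A B C : Ideal R} (h : HasChain P i A B)
    (h' : HasChain P j B C) : HasChain P (i + j) A C := by
  induction j generalizing C with
  | zero => exact h.mono_right h'
  | succ j ih =>
    obtain ⟨D, hD, hDB, hs⟩ := h'
    exact ⟨D, ih hD, hDB, hs⟩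

/-- If some `r * m` with `r * w ∉ P` lies in `(C ⊓ E) ⊔ N`, its `N`-component generates a copy of
the left ideal of `r * w` modulo `P`, and the step survives in the intersections. Otherwise `m`
keeps its annihilator modulo `(C ⊓ E) ⊔ N`, and the step survives in the sums. -/
theorem Step.inf_or_sup {D E : Ideal R} (h : Step P D E) (hDE : D ≤ E) (N : Ideal R) :
    Step P (D ⊓ N) (E ⊓ N) ∨ Step P (D ⊔ N) (E ⊔ N) := by
  obtain ⟨C, hC, m, hm, w, hw, H⟩ := h
  by_cases hex : ∃ r, r * w ∉ P ∧ r * m ∈ (C ⊓ E) ⊔ N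
  · obtain ⟨r, hr, hrm⟩ := hex
    obtain ⟨c, hc, n, hn, hcn⟩ := Submodule.mem_sup.1 hrm
    left
    refine ⟨C ⊓ E, le_inf (inf_le_left.trans hC) (inf_le_left.trans hDE), n, ⟨?_, hn⟩, r * w, hr,
      fun s => ?_⟩
    · have : n = r * m - c := by rw [← hcn]; abel
      rw [this]
      exact E.sub_mem (E.mul_mem_left r hm) hc.2
    · have e : s * n = s * r * m - s * c := by rw [mul_assoc, ← hcn]; noncomm_ring
      have hnE : s * n ∈ E := by
        rw [e]; exact E.sub_mem (E.mul_mem_left _ hm) (E.mul_mem_left _ hc.2)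
      have hsc : s * c ∈ C := C.mul_mem_left _ hc.1
      rw [← mul_assoc, ← H (s * r)]
      constructor
      · intro hx
        have : s * r * m = s * n + s * c := by rw [e]; abel
        rw [this]
        exact C.add_mem hx.1 hsc
      · intro hx
        refine ⟨?_, hnE⟩
        rw [e]; exact C.sub_mem hx hsc
  · push Not at hex
    right
    refine ⟨(C ⊓ E) ⊔ N, sup_le_sup_right (le_inf hC hDE) N, m, Submodule.mem_sup_left hm, w, hw,
      fun r => ⟨fun hr => ?_, fun hr => ?_⟩⟩
    · by_contra hcon
      exact hex r hcon hr
    · exact Submodule.mem_sup_left ⟨(H r).2 hr, E.mul_mem_left _ hm⟩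

theorem HasChain.split {k : ℕ} {A B : Ideal R} (h : HasChain P k A B) (N : Ideal R) :
    ∃ i j, k ≤ i + j ∧ HasChain P i (A ⊓ N) (B ⊓ N) ∧ HasChain P j (A ⊔ N) (B ⊔ N) := by
  induction k generalizing B with
  | zero => exact ⟨0, 0, le_rfl, inf_le_inf_right N h, sup_le_sup_right h N⟩
  | succ k ih =>
    obtain ⟨D, hD, hDB, hs⟩ := h
    obtain ⟨i, j, hk, hi, hj⟩ := ih hD
    rcases hs.inf_or_sup hDB N with h' | h'
    · exact ⟨i + 1, j, by omega, ⟨_, hi, inf_le_inf_right N hDB, h'⟩,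
        hj.mono_right (sup_le_sup_right hDB N)⟩
    · exact ⟨i, j + 1, by omega, hi.mono_right (inf_le_inf_right N hDB),
        ⟨_, hj, sup_le_sup_right hDB N, h'⟩⟩

variable (P) in
/-- The rank of the subquotient `B / A`: the supremum of the lengths of chains from `A` to `B`. -/
noncomputable def rk (A B : Ideal R) : ℕ∞ := ⨆ (n : ℕ) (_ : HasChain P n A B), (n : ℕ∞)

theorem HasChain.le_rk {n : ℕ} {A B : Ideal R} (h : HasChain P n A B) : (n : ℕ∞) ≤ rk P A B :=
  le_iSup₂_of_le n h le_rfl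

theorem rk_le_of_forall {A B : Ideal R} {a : ℕ∞} (h : ∀ n, HasChain P n A B → (n : ℕ∞) ≤ a) :
    rk P A B ≤ a := iSup₂_le h

theorem rk_le_of_imp {R' : Type*} [Ring R'] {P' : TwoSidedIdeal R'} {A B : Ideal R}
    {A' B' : Ideal R'} (h : ∀ n, HasChain P n A B → HasChain P' n A' B') :
    rk P A B ≤ rk P' A' B' := rk_le_of_forall fun n hn => (h n hn).le_rk

theorem rk_mono {A A' B B' : Ideal R} (hA : A' ≤ A) (hB : B ≤ B') : rk P A B ≤ rk P A' B' :=
  rk_le_of_imp fun _ hn => (hn.mono_left hA).mono_right hB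

theorem rk_eq_zero {A B : Ideal R} (h : ∀ X Y, A ≤ X → Y ≤ B → ¬ Step P X Y) :
    rk P A B = 0 := by
  refine le_antisymm (rk_le_of_forall fun n hn => ?_) bot_le
  cases n with
  | zero => simp
  | succ n =>
    obtain ⟨D, hD, hDB, hs⟩ := hn
    exact absurd hs (h _ _ hD.le le_rfl)

theorem rk_self (A : Ideal R) : rk P A A = 0 :=
  rk_eq_zero fun _ _ hX hY hs => hs.not_le (hY.trans hX)

theorem rk_le_add (A B N : Ideal R) :
    rk P A B ≤ rk P (A ⊓ N) (B ⊓ N) + rk P (A ⊔ N) (B ⊔ N) := by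
  refine rk_le_of_forall fun n hn => ?_
  obtain ⟨i, j, hk, hi, hj⟩ := hn.split N
  calc (n : ℕ∞) ≤ ((i + j : ℕ) : ℕ∞) := by exact_mod_cast hk
    _ = i + j := by push_cast; rfl
    _ ≤ _ := add_le_add hi.le_rk hj.le_rk

theorem rk_add {A N B : Ideal R} (hA : A ≤ N) (hB : N ≤ B) :
    rk P A N + rk P N B = rk P A B := by
  refine le_antisymm ?_ ?_
  · refine ENat.biSup_add_biSup_le' ⟨0, hA⟩ ⟨0, hB⟩ fun i hi j hj => ?_
    exact_mod_cast (hi.trans hj).le_rk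
  · simpa [inf_eq_left.2 hA, inf_eq_right.2 hB, sup_eq_right.2 hA, sup_eq_left.2 hB] using
      rk_le_add (P := P) A B N

/-- The second isomorphism theorem for ranks: each inequality is `rk_le_add` with one summand of the
form `rk P A A`. -/
theorem rk_inf_sup (X Y : Ideal R) : rk P (X ⊓ Y) X = rk P Y (X ⊔ Y) := by
  refine le_antisymm ?_ ?_
  · have := rk_le_add (P := P) (X ⊓ Y) X Y
    simpa [inf_assoc, rk_self] using this
  · have := rk_le_add (P := P) Y (X ⊔ Y) X
    have e : X ⊔ Y ⊔ X = Y ⊔ X := by rw [sup_comm X Y, sup_assoc, sup_idem]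
    have e' : (X ⊔ Y) ⊓ X = X := inf_eq_right.2 le_sup_left
    rw [e, e', rk_self, add_zero, inf_comm] at this
    exact this

theorem rk_sup_le {A N B : Ideal R} (hAB : A ≤ B) : rk P (A ⊔ N) (B ⊔ N) ≤ rk P A B := by
  have e : B ⊔ N = B ⊔ (A ⊔ N) := by rw [← sup_assoc, sup_eq_left.2 hAB]
  rw [e, ← rk_inf_sup]
  exact rk_mono (le_inf hAB le_sup_left) le_rfl

/-- Right multiplication by `c`, as a map of left modules. -/
abbrev mulRightHom (c : R) : R →ₗ[R] R := LinearMap.toSpanSingleton R R c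

theorem Step.comap {X Y : Ideal R} (h : Step P X Y) (f : R →ₗ[R] R)
    (hY : Y ≤ LinearMap.range f) : Step P (Submodule.comap f X) (Submodule.comap f Y) := by
  obtain ⟨C, hC, m, hm, w, hw, H⟩ := h
  obtain ⟨m, rfl⟩ := hY hm
  refine ⟨Submodule.comap f C, Submodule.comap_mono hC, m, hm, w, hw, fun r => ?_⟩
  rw [← H r, Submodule.mem_comap, ← smul_eq_mul, map_smul, smul_eq_mul]

theorem HasChain.comap {n : ℕ} {X Y : Ideal R} (h : HasChain P n X Y) (f : R →ₗ[R] R)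
    (hY : Y ≤ LinearMap.range f) :
    HasChain P n (Submodule.comap f X) (Submodule.comap f Y) := by
  induction n generalizing Y with
  | zero => exact Submodule.comap_mono h
  | succ n ih =>
    obtain ⟨D, hD, hDB, hs⟩ := h
    exact ⟨_, ih hD (hDB.trans hY), Submodule.comap_mono hDB, hs.comap f hY⟩

theorem Step.map {X Y : Ideal R} (h : Step P X Y) {f : R →ₗ[R] R}
    (hf : Function.Injective f) : Step P (Submodule.map f X) (Submodule.map f Y) := by
  obtain ⟨C, hC, m, hm, w, hw, H⟩ := h
  refine ⟨Submodule.map f C, Submodule.map_mono hC, f m, Submodule.mem_map_of_mem hm, w, hw,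
    fun r => ?_⟩
  rw [← H r, ← smul_eq_mul, ← map_smul, ← smul_eq_mul]
  exact ⟨fun ⟨y, hy, e⟩ => hf e ▸ hy, fun h => Submodule.mem_map_of_mem h⟩

theorem HasChain.map {n : ℕ} {X Y : Ideal R} (h : HasChain P n X Y) {f : R →ₗ[R] R}
    (hf : Function.Injective f) :
    HasChain P n (Submodule.map f X) (Submodule.map f Y) := by
  induction n generalizing Y with
  | zero => exact Submodule.map_mono h
  | succ n ih =>
    obtain ⟨D, hD, hDB, hs⟩ := h
    exact ⟨_, ih hD, Submodule.map_mono hDB, hs.map hf⟩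

theorem rk_le_rk_comap {X Y : Ideal R} (f : R →ₗ[R] R) (hY : Y ≤ LinearMap.range f) :
    rk P X Y ≤ rk P (Submodule.comap f X) (Submodule.comap f Y) :=
  rk_le_of_imp fun _ h => h.comap f hY

theorem rk_map {A B : Ideal R} {f : R →ₗ[R] R} (hf : Function.Injective f) :
    rk P (Submodule.map f A) (Submodule.map f B) = rk P A B := by
  refine le_antisymm ?_ (rk_le_of_imp fun _ h => h.map hf)
  refine (rk_le_rk_comap f LinearMap.map_le_range).trans ?_
  rw [Submodule.comap_map_eq_of_injective hf, Submodule.comap_map_eq_of_injective hf]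

theorem HasChain.comap_ringEquiv {n : ℕ} {A B : Ideal R} (h : HasChain P n A B) (σ : R ≃+* R)
    (hσ : ∀ r, r ∈ P ↔ σ r ∈ P) : HasChain P n (Ideal.comap σ A) (Ideal.comap σ B) := by
  induction n generalizing B with
  | zero => exact Ideal.comap_mono h
  | succ n ih =>
    obtain ⟨D, hD, hDB, C, hC, m, hm, w, hw, H⟩ := h
    refine ⟨_, ih hD, Ideal.comap_mono hDB, Ideal.comap σ C, Ideal.comap_mono hC, σ.symm m,
      by rwa [Ideal.mem_comap, σ.apply_symm_apply], σ.symm w, by rwa [hσ, σ.apply_symm_apply], fun r => ?_⟩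
    rw [Ideal.mem_comap, map_mul, σ.apply_symm_apply, H, hσ (r * _), map_mul, σ.apply_symm_apply]

theorem rk_comap_ringEquiv (A B : Ideal R) (σ : R ≃+* R) (hσ : ∀ r, r ∈ P ↔ σ r ∈ P) :
    rk P (Ideal.comap σ A) (Ideal.comap σ B) = rk P A B := by
  refine le_antisymm (rk_le_of_imp fun n h => ?_)
    (rk_le_of_imp fun _ h => h.comap_ringEquiv σ hσ)
  have := h.comap_ringEquiv σ.symm fun r => by rw [hσ (σ.symm r), σ.apply_symm_apply]
  have e : ∀ X : Ideal R, Ideal.comap σ.symm (Ideal.comap σ X) = X := fun X => by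
    ext; rw [Ideal.mem_comap, Ideal.mem_comap, σ.apply_symm_apply]
  rwa [e, e] at this

end Rank

/-! ### Goldie theory of prime left noetherian rings -/

section Prime

variable {R : Type*} [Ring R] {P : TwoSidedIdeal R}

/-- Elementwise primeness, without properness. -/
def ElemPrime (P : TwoSidedIdeal R) : Prop :=
  ∀ a b : R, (∀ r, a * r * b ∈ P) → a ∈ P ∨ b ∈ P

/-- Apply primeness to the right annihilator `L` of `aR` modulo `P` and the left annihilator `J` of
`L` modulo `P`; both are two-sided. -/
theorem IsPrime.elemPrime (hP : IsPrime P) : ElemPrime P := by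
  intro a b hab
  let L : TwoSidedIdeal R := .mk' {y | ∀ r, a * r * y ∈ P}
    (fun r => by simp) (fun {x y} hx hy r => by rw [mul_add]; exact P.add_mem (hx r) (hy r))
    (fun {x} hx r => by rw [mul_neg]; exact P.neg_mem (hx r))
    (fun {x y} hy r => by have := hy (r * x); simpa only [mul_assoc] using this)
    (fun {x y} hx r => by rw [← mul_assoc]; exact P.mul_mem_right _ _ (hx r))
  let J : TwoSidedIdeal R := .mk' {x | ∀ y ∈ L, x * y ∈ P}
    (fun y _ => by simp) (fun {x x'} hx hx' y hy => by
      rw [add_mul]; exact P.add_mem (hx y hy) (hx' y hy))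
    (fun {x} hx y hy => by rw [neg_mul]; exact P.neg_mem (hx y hy))
    (fun {x x'} hx y hy => by rw [mul_assoc]; exact P.mul_mem_left _ _ (hx y hy))
    (fun {x x'} hx y hy => by rw [mul_assoc]; exact hx _ (L.mul_mem_left _ _ hy))
  have hb : b ∈ L := (TwoSidedIdeal.mem_mk' ..).2 hab
  have ha : a ∈ J := (TwoSidedIdeal.mem_mk' ..).2 fun y hy => by
    have := (TwoSidedIdeal.mem_mk' ..).1 hy 1
    simpa using this
  refine (hP.2 J L fun x hx y hy => (TwoSidedIdeal.mem_mk' ..).1 hx y hy).imp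
    (fun h => h ha) (fun h => h hb)

theorem ElemPrime.isPrime (hP : ElemPrime P) (h1 : P ≠ ⊤) : IsPrime P := by
  refine ⟨h1, fun J L hJL => ?_⟩
  by_contra! hcon
  obtain ⟨a, ha, haP⟩ := Set.not_subset.1 (mt TwoSidedIdeal.le_iff.2 hcon.1)
  obtain ⟨b, hb, hbP⟩ := Set.not_subset.1 (mt TwoSidedIdeal.le_iff.2 hcon.2)
  exact (hP a b fun r => hJL _ (J.mul_mem_right _ _ ha) _ hb).elim haP hbP

variable [IsNoetherianRing R]

theorem exists_maximal_ideal_of {S : Ideal R → Prop} {A : Ideal R} (hA : S A) :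
    ∃ M, S M ∧ ∀ N, S N → M ≤ N → N = M := by
  obtain ⟨M, hM, h⟩ := wellFounded_gt.has_min {X : Ideal R | S X} ⟨A, hA⟩
  exact ⟨M, hM, fun N hN hle => (hle.eq_or_lt.resolve_right (h N hN)).symm⟩

/-- A prime left noetherian ring is nonsingular: an element whose left annihilator modulo `P` is
essential modulo `P` is in `P`. -/
theorem ElemPrime.nonsingular (hP : ElemPrime P) {w : R}
    (hw : ∀ d, d ∉ P → ∃ s, s * d ∉ P ∧ s * d * w ∈ P) : w ∈ P := by
  by_contra hwP
  let ann : R → Ideal R := fun z =>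
    Submodule.comap (mulRightHom z) P.asIdeal
  have mem_ann : ∀ z r, r ∈ ann z ↔ r * z ∈ P := fun z r => by
    simp [ann, TwoSidedIdeal.mem_asIdeal]
  -- Among counterexamples, `z` has maximal left annihilator. If `z * a * z ∉ P`, it is another
  -- counterexample with the same annihilator; essentiality for `a * z`, tested at `z`, gives `s * z
  -- ∉ P` with `s * z * a * z ∈ P`, a contradiction.
  obtain ⟨M, ⟨z, hz, hzP, rfl⟩, hmax⟩ := exists_maximal_ideal_of
    (S := fun X => ∃ z, (∀ d, d ∉ P → ∃ s, s * d ∉ P ∧ s * d * z ∈ P) ∧ z ∉ P ∧ ann z = X)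
    ⟨w, hw, hwP, rfl⟩
  refine hzP ((hP z z fun a => ?_).elim id id)
  by_contra hza
  have key : ∀ b d, d ∉ P → ∃ s, s * d ∉ P ∧ s * d * (b * z) ∈ P := by
    intro b d hd
    by_cases hdb : d * b ∈ P
    · exact ⟨1, by simpa using hd, by
        rw [one_mul, ← mul_assoc]; exact P.mul_mem_right _ _ hdb⟩
    · obtain ⟨s, h1, h2⟩ := hz _ hdb
      refine ⟨s, fun h => h1 ?_, ?_⟩
      · rw [← mul_assoc]; exact P.mul_mem_right _ _ h
      · simpa only [mul_assoc] using h2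
  have heq := hmax (ann (z * a * z)) ⟨_, key (z * a), hza, rfl⟩ fun r hr => by
    rw [mem_ann] at hr ⊢
    rw [← mul_assoc, ← mul_assoc]
    exact P.mul_mem_right _ _ (P.mul_mem_right _ _ hr)
  obtain ⟨s, h1, h2⟩ := key a z hzP
  refine h1 ((mem_ann z s).1 ?_)
  rw [← heq, mem_ann]
  simpa only [mul_assoc] using h2

/-- If every left ideal inside `Y` and outside `P` met `X` outside `P`, the left annihilator of `w`
modulo `P` would be essential, so `w ∈ P` by nonsingularity. -/
theorem Step.exists_disjoint (hP : ElemPrime P) {X Y : Ideal R} (h : Step P X Y)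
    (hX : P.asIdeal ≤ X) : ∃ D ≤ Y, ¬ D ≤ P.asIdeal ∧ D ⊓ X ≤ P.asIdeal := by
  obtain ⟨C, hC, m, hm, w, hw, H⟩ := h
  by_contra! hcon
  refine hw (hP.nonsingular fun d hd => ?_)
  let D : Ideal R := Submodule.span R {d * m}
  have hDY : D ≤ Y := by
    rw [Submodule.span_le, Set.singleton_subset_iff]; exact Y.mul_mem_left _ hm
  by_cases hDP : D ≤ P.asIdeal
  · refine ⟨1, by simpa using hd, ?_⟩
    rw [one_mul, ← H]
    exact hC (hX (hDP (Submodule.mem_span_singleton_self _)))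
  · obtain ⟨y, hy, hyP⟩ := Set.not_subset.1 (hcon D hDY hDP)
    obtain ⟨s, rfl⟩ := Submodule.mem_span_singleton.1 hy.1
    rw [smul_eq_mul, ← mul_assoc] at hy hyP
    refine ⟨s, fun h => hyP ?_, (H _).1 (hC hy.2)⟩
    exact TwoSidedIdeal.mem_asIdeal.2 (P.mul_mem_right _ _ h)

theorem Step.exists_disjoint_ge (hP : ElemPrime P) {X Y : Ideal R} (h : Step P X Y)
    (hX : P.asIdeal ≤ X) (hY : P.asIdeal ≤ Y) :
    ∃ D ≤ Y, P.asIdeal ≤ D ∧ ¬ D ≤ P.asIdeal ∧ D ⊓ X ≤ P.asIdeal := by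
  obtain ⟨D, hDY, hDP, hDX⟩ := h.exists_disjoint hP hX
  refine ⟨D ⊔ P.asIdeal, sup_le hDY hY, le_sup_right, fun h => hDP (le_sup_left.trans h), ?_⟩
  rw [sup_comm, sup_inf_assoc_of_le D hX]
  exact sup_le le_rfl hDX

/-- Take `X` maximal among left ideals that meet some nonzero `Y ≤ D` trivially, everything modulo
`P`. If `Y` had independent nonzero parts `Y₁` and `Y₂`, then `X ⊔ Y₁` would be larger and still
meet `Y₂` trivially. -/
theorem exists_uniform {D : Ideal R} (hPD : P.asIdeal ≤ D) (hD : ¬ D ≤ P.asIdeal) :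
    ∃ Y ≤ D, P.asIdeal ≤ Y ∧ ¬ Y ≤ P.asIdeal ∧ ∀ Y₁ ≤ Y, ∀ Y₂ ≤ Y,
      P.asIdeal ≤ Y₁ → P.asIdeal ≤ Y₂ → Y₁ ⊓ Y₂ ≤ P.asIdeal →
        Y₁ ≤ P.asIdeal ∨ Y₂ ≤ P.asIdeal := by
  obtain ⟨X, ⟨hPX, Y, hYD, hPY, hYP, hXY⟩, hmax⟩ := exists_maximal_ideal_of
    (S := fun X => P.asIdeal ≤ X ∧ ∃ Y ≤ D, P.asIdeal ≤ Y ∧ ¬ Y ≤ P.asIdeal ∧ X ⊓ Y ≤ P.asIdeal)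
    (A := P.asIdeal) ⟨le_rfl, D, le_rfl, hPD, hD, inf_le_left⟩
  refine ⟨Y, hYD, hPY, hYP, fun Y₁ h₁ Y₂ h₂ hP₁ hP₂ h => ?_⟩
  by_contra! hcon
  refine hcon.1 ?_
  have := hmax (X ⊔ Y₁) ⟨hPX.trans le_sup_left, Y₂, h₂.trans hYD, hP₂, hcon.2, ?_⟩ le_sup_left
  · exact (le_inf (sup_eq_left.1 this) h₁).trans hXY
  · refine le_trans (le_inf ?_ inf_le_right) h
    calc (X ⊔ Y₁) ⊓ Y₂ ≤ (Y₁ ⊔ X) ⊓ Y := by rw [sup_comm]; exact inf_le_inf_left _ h₂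
      _ = Y₁ ⊔ X ⊓ Y := sup_inf_assoc_of_le X h₁
      _ ≤ Y₁ := sup_le le_rfl (hXY.trans hP₁)

/-- A maximal `B` of finite rank over `P` is essential modulo `P`: otherwise a uniform `Y`
independent of `B` could be added, at the cost of rank at most one. Over an essential `B` no step
exists, by `Step.exists_disjoint_ge`. -/
theorem ElemPrime.rk_ne_top (hP : ElemPrime P) : rk P P.asIdeal ⊤ ≠ ⊤ := by
  obtain ⟨B, ⟨hPB, hB⟩, hmax⟩ := exists_maximal_ideal_of
    (S := fun B => P.asIdeal ≤ B ∧ rk P P.asIdeal B ≠ ⊤) (A := P.asIdeal)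
    ⟨le_rfl, by simp [rk_self]⟩
  have hess : ∀ D, P.asIdeal ≤ D → D ⊓ B ≤ P.asIdeal → D ≤ P.asIdeal := by
    intro D hPD hDB
    by_contra hD
    obtain ⟨Y, hYD, hPY, hYP, hY⟩ := exists_uniform hPD hD
    have h1 : rk P P.asIdeal Y ≤ 1 := by
      refine rk_le_of_forall fun n hn => ?_
      match n, hn with
      | 0, _ => simp
      | 1, _ => simp
      | n + 2, ⟨X, ⟨Z, hZ, hZX, hs⟩, hXY, hs'⟩ =>
        obtain ⟨E, hEY, hPE, hEP, hEX⟩ :=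
          hs'.exists_disjoint_ge hP (hZ.le.trans hZX) hPY
        rcases hY E hEY X hXY hPE (hZ.le.trans hZX) hEX with h | h
        · exact absurd h hEP
        · exact absurd (h.trans hZ.le) hs.not_le
    have h2 : rk P P.asIdeal (B ⊔ Y) ≠ ⊤ := by
      rw [← rk_add hPB le_sup_left, sup_comm, ← rk_inf_sup]
      have : rk P (Y ⊓ B) Y ≤ 1 := (rk_mono (le_inf hPY hPB) le_rfl).trans h1
      exact ENat.add_eq_top.not.2 (not_or.2 ⟨hB, ne_top_of_le_ne_top ENat.one_ne_top this⟩)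
    have h3 := hmax _ ⟨hPB.trans le_sup_left, h2⟩ le_sup_left
    exact hYP ((le_inf hYD (sup_eq_left.1 h3)).trans hDB)
  have h0 : rk P B ⊤ = 0 := rk_eq_zero fun X Y hX _ hs => by
    obtain ⟨D, -, hPD, hDP, hDX⟩ :=
      (hs.mono le_rfl le_top).exists_disjoint_ge hP (hPB.trans hX) le_top
    exact hDP (hess D hPD ((inf_le_inf_left _ hX).trans hDX))
  rw [← rk_add hPB le_top, h0, add_zero]
  exact hB

omit [IsNoetherianRing R] in
theorem mem_ker_mulRightHom {c r : R} : r ∈ LinearMap.ker (mulRightHom c) ↔ r * c = 0 := by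
  simp

/-- A nonzero left ideal of a prime left noetherian ring is not nil. -/
theorem ElemPrime.exists_not_isNilpotent (hR : ElemPrime (⊥ : TwoSidedIdeal R)) {L : Ideal R}
    (hL : L ≠ ⊥) : ∃ a ∈ L, ¬ IsNilpotent a := by
  by_contra! hnil
  obtain ⟨b, hbL, hb⟩ := Submodule.exists_mem_ne_zero_of_ne_bot hL
  obtain ⟨M, ⟨a, haL, ha, rfl⟩, hmax⟩ := exists_maximal_ideal_of
    (S := fun X => ∃ a ∈ L, a ≠ 0 ∧ LinearMap.ker (mulRightHom a) = X) ⟨b, hbL, hb, rfl⟩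
  refine ha ?_
  refine (hR a a fun r => ?_).elim id id
  rw [TwoSidedIdeal.mem_bot]
  have hex : ∃ n, a * (r * a) ^ n = 0 := by
    obtain ⟨n, hn⟩ := hnil (r * a) (L.mul_mem_left _ haL)
    exact ⟨n, by rw [hn, mul_zero]⟩
  classical
  obtain ⟨j, hj⟩ : ∃ j, Nat.find hex = j + 1 := by
    refine Nat.exists_eq_succ_of_ne_zero fun h0 => ha ?_
    have := Nat.find_spec hex
    rwa [h0, pow_zero, mul_one] at this
  have h1 : a * (r * a) ^ (j + 1) = 0 := hj ▸ Nat.find_spec hex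
  have h2 : a * (r * a) ^ j ≠ 0 := Nat.find_min hex (by omega)
  have hL' : a * (r * a) ^ j ∈ L := by
    cases j with
    | zero => simpa using haL
    | succ j =>
      rw [pow_succ, ← mul_assoc, ← mul_assoc]
      exact L.mul_mem_left _ haL
  -- The last nonzero `a * (r * a) ^ j` has the same left annihilator as `a`, by maximality. It is
  -- killed by `a * r`, hence `a * r * a = 0`.
  have heq := hmax _ ⟨_, hL', h2, rfl⟩ fun s hs => by
    rw [mem_ker_mulRightHom] at hs ⊢
    rw [← mul_assoc, hs, zero_mul]
  rw [← mem_ker_mulRightHom, ← heq, mem_ker_mulRightHom]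
  rw [pow_succ'] at h1
  simpa only [mul_assoc] using h1

/-- The left annihilators of the powers of a non-nilpotent `a` stabilise, so a high power of `a`
works. -/
theorem ElemPrime.exists_mul_self (hR : ElemPrime (⊥ : TwoSidedIdeal R)) {L : Ideal R}
    (hL : L ≠ ⊥) : ∃ a ∈ L, a ≠ 0 ∧ ∀ r, r * a * a = 0 → r * a = 0 := by
  obtain ⟨a, haL, ha⟩ := hR.exists_not_isNilpotent hL
  let f : ℕ →o Ideal R := ⟨fun n => LinearMap.ker (mulRightHom (a ^ n)),
    monotone_nat_of_le_succ fun n r hr => by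
      rw [mem_ker_mulRightHom] at hr ⊢
      rw [pow_succ, ← mul_assoc, hr, zero_mul]⟩
  obtain ⟨n, hn⟩ := monotone_stabilizes_iff_noetherian.2 ‹IsNoetherianRing R› f
  refine ⟨a ^ (n + 1), by rw [pow_succ]; exact L.mul_mem_left _ haL, fun h => ha ⟨_, h⟩,
    fun r hr => ?_⟩
  rw [mul_assoc, ← pow_add, ← mem_ker_mulRightHom] at hr
  rw [← mem_ker_mulRightHom]
  exact (hn (n + 1) (by omega)).le ((hn (n + 1 + (n + 1)) (by omega)).ge hr)

/-- A nonzero ideal of a prime left noetherian ring contains an element with zero left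
annihilator. -/
theorem ElemPrime.exists_regular (hR : ElemPrime (⊥ : TwoSidedIdeal R)) {Q : TwoSidedIdeal R}
    (hQ : Q ≠ ⊥) : ∃ c ∈ Q, ∀ r, r * c = 0 → r = 0 := by
  by_contra! hcon
  -- While `c` has nonzero left annihilator, pick `a ≠ 0` in `Q` with `a * c = 0`. The annihilator
  -- of `c + a` is then the intersection of those of `c` and `a`, and `a` itself witnesses one more
  -- step. Unboundedly long chains contradict finite rank.
  have key : ∀ n : ℕ, ∃ c ∈ Q, (∀ r, r * c * c = 0 → r * c = 0) ∧
      HasChain (⊥ : TwoSidedIdeal R) n (LinearMap.ker (mulRightHom c)) ⊤ := by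
    intro n
    induction n with
    | zero => exact ⟨0, Q.zero_mem, by simp, le_top⟩
    | succ n ih =>
      obtain ⟨c, hcQ, hc, hch⟩ := ih
      obtain ⟨s, hs, hs0⟩ := hcon c hcQ
      have hL : Q.asIdeal ⊓ LinearMap.ker (mulRightHom c) ≠ ⊥ := by
        intro hbot
        obtain ⟨q, hq, hq0⟩ : ∃ q ∈ Q, q ≠ 0 := by
          by_contra! h
          exact hQ (eq_bot_iff.2 fun x hx => (TwoSidedIdeal.mem_bot R).2 (h x hx))
        refine (hR q s fun r => ?_).elim (fun h => hq0 ((TwoSidedIdeal.mem_bot R).1 h))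
          (fun h => hs0 ((TwoSidedIdeal.mem_bot R).1 h))
        have : q * r * s ∈ Q.asIdeal ⊓ LinearMap.ker (mulRightHom c) :=
          ⟨TwoSidedIdeal.mem_asIdeal.2 (Q.mul_mem_right _ _ (Q.mul_mem_right _ _ hq)), by
            rw [SetLike.mem_coe, mem_ker_mulRightHom, mul_assoc, hs, mul_zero]⟩
        rw [hbot] at this
        exact this
      obtain ⟨a, ⟨haQ, hac⟩, ha0, ha⟩ := hR.exists_mul_self hL
      rw [SetLike.mem_coe, mem_ker_mulRightHom] at hac
      have hker : ∀ r, r * (c + a) = 0 → r * c = 0 ∧ r * a = 0 := by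
        intro r hr
        rw [mul_add] at hr
        have h1 : r * c = 0 := hc r (by
          have : r * c * c + r * (a * c) = (r * c + r * a) * c := by noncomm_ring
          rw [hac, hr, mul_zero, zero_mul, add_zero] at this
          exact this)
        rw [h1, zero_add] at hr
        exact ⟨h1, hr⟩
      refine ⟨c + a, Q.add_mem hcQ haQ, fun r hr => ?_, ?_⟩
      · obtain ⟨h1, h2⟩ := hker _ hr
        have h3 : r * c = 0 := hc r (by
          have : r * (c + a) * c = r * c * c + r * (a * c) := by noncomm_ring
          rwa [h1, hac, mul_zero, add_zero, eq_comm] at this)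
        have h4 : r * a = 0 := ha r (by
          have : r * (c + a) * a = r * c * a + r * a * a := by noncomm_ring
          rwa [h2, h3, zero_mul, zero_add, eq_comm] at this)
        rw [mul_add, h3, h4, add_zero]
      · rw [show n + 1 = 0 + 1 + n by omega]
        refine HasChain.trans (i := 0 + 1) (B := LinearMap.ker (mulRightHom c)) ⟨_, le_rfl, ?_, ?_⟩ hch
        · exact fun r hr => mem_ker_mulRightHom.2 (hker r (mem_ker_mulRightHom.1 hr)).1
        · refine ⟨_, le_rfl, a, mem_ker_mulRightHom.2 hac, a,
            fun h => ha0 ((TwoSidedIdeal.mem_bot R).1 h), fun r => ?_⟩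
          rw [mem_ker_mulRightHom, TwoSidedIdeal.mem_bot]
          exact ⟨fun h => ha r (hker _ h).2, fun h => by rw [h, zero_mul]⟩
  refine hR.rk_ne_top (ENat.eq_top_iff_forall_ge.2 fun n => ?_)
  obtain ⟨c, -, -, h⟩ := key n
  exact (h.mono_left bot_le).le_rk

end Prime

/-! ### Principal ideal theorem for normal elements -/

section PrincipalIdealTheorem

variable {R : Type*} [Ring R] [IsNoetherianRing R] {P : TwoSidedIdeal R}

theorem wellFoundedGT_twoSidedIdeal : WellFoundedGT (TwoSidedIdeal R) := by
  refine ⟨Subrelation.wf ?_ (InvImage.wf (fun I : TwoSidedIdeal R => I.asIdeal)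
    (wellFounded_gt (α := Ideal R)))⟩
  intro I J h
  exact lt_of_le_not_ge (TwoSidedIdeal.asIdeal.monotone (le_of_lt h)) fun h' =>
    not_le_of_gt h fun x hx => h' hx

/-- `C / J` is a finitely generated left module killed by `B`, so it is built from finitely many
quotients of `R / B`. -/
theorem rk_ne_top_of_mul_le {B C J : TwoSidedIdeal R} (hJC : J ≤ C)
    (hBC : ∀ b ∈ B, ∀ c ∈ C, b * c ∈ J) (hB : rk P B.asIdeal ⊤ ≠ ⊤) :
    rk P J.asIdeal C.asIdeal ≠ ⊤ := by
  have key : ∀ N : Ideal R, N.FG → N ≤ C.asIdeal → rk P J.asIdeal (J.asIdeal ⊔ N) ≠ ⊤ := by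
    intro N hN
    induction N, hN using Submodule.fg_induction with
    | singleton c =>
      intro hc
      have hcC : c ∈ C := hc (Submodule.mem_span_singleton_self c)
      rw [sup_comm, ← rk_inf_sup]
      refine ne_top_of_le_ne_top hB ((rk_le_rk_comap (mulRightHom c) ?_).trans
        (rk_mono ?_ le_top))
      · rw [LinearMap.range_toSpanSingleton]
      · intro b hb
        exact ⟨Submodule.smul_mem _ _ (Submodule.mem_span_singleton_self c), hBC b hb c hcC⟩
    | sup N₁ N₂ _ _ h₁ h₂ =>
      intro h
      rw [← sup_assoc, ← rk_add (le_sup_left (b := N₁)) le_sup_left]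
      refine ENat.add_eq_top.not.2 (not_or.2 ⟨h₁ (le_sup_left.trans h), ?_⟩)
      have := rk_sup_le (P := P) (N := N₁) (le_sup_left : J.asIdeal ≤ J.asIdeal ⊔ N₂)
      rw [sup_right_comm] at this
      exact ne_top_of_le_ne_top (h₂ (le_sup_right.trans h)) this
  have := key C.asIdeal (IsNoetherian.noetherian _) le_rfl
  rwa [sup_eq_right.2 (show J.asIdeal ≤ C.asIdeal from hJC)] at this

omit [IsNoetherianRing R] in
theorem rk_eq_zero_of_not_le (hP : ElemPrime P) {J : TwoSidedIdeal R} (hJ : ¬ J ≤ P) :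
    rk P J.asIdeal ⊤ = 0 := by
  refine rk_eq_zero fun X Y hX _ ⟨C, hC, m, _, w, hw, H⟩ => ?_
  obtain ⟨j, hj, hjP⟩ := Set.not_subset.1 (mt TwoSidedIdeal.le_iff.2 hJ)
  refine (hP j w fun r => ?_).elim hjP hw
  rw [← H]
  exact hC (hX (J.mul_mem_right _ _ (J.mul_mem_right _ _ hj)))

/-- Noetherian induction on `J`. A prime `J ≤ P` equals `P` by minimality. A non-prime `J` contains
a product of two strictly larger ideals, which are covered by induction, and rank is additive. -/
theorem rk_ne_top_of_mem (hP : IsPrime P) {x : R}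
    (hmin : ∀ Q : TwoSidedIdeal R, IsPrime Q → x ∈ Q → Q ≤ P → Q = P) (J : TwoSidedIdeal R)
    (hx : x ∈ J) : rk P J.asIdeal ⊤ ≠ ⊤ := by
  have := wellFoundedGT_twoSidedIdeal (R := R)
  induction J using WellFoundedGT.induction with
  | ind J ih =>
  by_cases hJP : J ≤ P
  swap
  · rw [rk_eq_zero_of_not_le hP.elemPrime hJP]; simp
  by_cases hJ : IsPrime J
  · rw [hmin J hJ hx hJP]
    exact hP.elemPrime.rk_ne_top
  have hJt : J ≠ ⊤ := fun h => hP.1 (top_le_iff.1 (h ▸ hJP))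
  have : ∃ B C : TwoSidedIdeal R, (∀ a ∈ B, ∀ b ∈ C, a * b ∈ J) ∧ ¬ B ≤ J ∧ ¬ C ≤ J := by
    by_contra! hcon
    exact hJ ⟨hJt, fun B C h => or_iff_not_imp_left.2 (hcon B C h)⟩
  obtain ⟨B, C, hBC, hB, hC⟩ := this
  have hB' : J < J ⊔ B := left_lt_sup.2 hB
  have hC' : J < J ⊔ C := left_lt_sup.2 hC
  have hmul : ∀ b ∈ J ⊔ B, ∀ c ∈ J ⊔ C, b * c ∈ J := by
    intro b hb c hc
    obtain ⟨j, hj, b, hbB, rfl⟩ := TwoSidedIdeal.mem_sup.1 hb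
    obtain ⟨i, hi, c, hcC, rfl⟩ := TwoSidedIdeal.mem_sup.1 hc
    rw [add_mul, mul_add b]
    exact J.add_mem (J.mul_mem_right _ _ hj) (J.add_mem (J.mul_mem_left _ _ hi) (hBC b hbB c hcC))
  rw [← rk_add (show J.asIdeal ≤ (J ⊔ C).asIdeal from hC'.le) le_top]
  exact ENat.add_eq_top.not.2 (not_or.2
    ⟨rk_ne_top_of_mul_le hC'.le hmul (ih _ hB' (hB'.le hx)), ih _ hC' (hC'.le hx)⟩)

theorem rk_span_singleton_ne_top (hP : IsPrime P) {x : R} {τ : R ≃+* R}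
    (hτ : ∀ a, x * a = τ a * x)
    (hmin : ∀ Q : TwoSidedIdeal R, IsPrime Q → x ∈ Q → Q ≤ P → Q = P) :
    rk P (Ideal.span {x}) ⊤ ≠ ⊤ := by
  let J : TwoSidedIdeal R := .mk' (Ideal.span {x}) (Ideal.zero_mem _) (Ideal.add_mem _)
    (neg_mem) (Ideal.mul_mem_left _ _) (fun {y a} hy => by
      obtain ⟨r, rfl⟩ := Ideal.mem_span_singleton'.1 hy
      rw [mul_assoc, hτ, ← mul_assoc]
      exact Ideal.mul_mem_left _ _ (Ideal.mem_span_singleton_self x))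
  have hJ : J.asIdeal = Ideal.span {x} := by
    ext y
    rw [TwoSidedIdeal.mem_asIdeal]
    exact TwoSidedIdeal.mem_mk' ..
  rw [← hJ]
  exact rk_ne_top_of_mem hP hmin J ((TwoSidedIdeal.mem_mk' ..).2 (Ideal.mem_span_singleton_self x))

omit [IsNoetherianRing R] in
theorem ElemPrime.mem_of_mul_normal {Q : TwoSidedIdeal R} (hQ : ElemPrime Q) {x : R} {τ : R ≃+* R}
    (hτ : ∀ a, x * a = τ a * x) (hx : x ∉ Q) {r : R} (hr : r * x ∈ Q) : r ∈ Q := by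
  refine (hQ r x fun a => ?_).resolve_right hx
  have : r * a * x = r * x * τ.symm a := by
    rw [mul_assoc r x, hτ, τ.apply_symm_apply, mul_assoc]
  rw [this]
  exact Q.mul_mem_right _ _ hr

omit [IsNoetherianRing R] in
theorem map_mulRightHom_span (x y : R) :
    Submodule.map (mulRightHom y) (Ideal.span {x}) = Ideal.span {x * y} := by
  rw [Ideal.span, Submodule.map_span, Set.image_singleton]
  simp [Ideal.span]

omit [IsNoetherianRing R] in
theorem map_mulRightHom_top (y : R) : Submodule.map (mulRightHom y) ⊤ = Ideal.span {y} := by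
  rw [← Ideal.span_singleton_one, map_mulRightHom_span, one_mul]

/-- The principal ideal theorem for a normal element `x` of a prime left noetherian ring: a prime
minimal over `x`, and stable under the automorphism that `x` induces, has height at most one. -/
theorem principal_ideal_theorem (hR : ElemPrime (⊥ : TwoSidedIdeal R)) (hP : IsPrime P) {x : R}
    (hx0 : x ≠ 0) (hxP : x ∈ P) {τ : R ≃+* R} (hτ : ∀ a, x * a = τ a * x) (hτP : ∀ r, r ∈ P ↔ τ r ∈ P)
    (hmin : ∀ Q : TwoSidedIdeal R, IsPrime Q → x ∈ Q → Q ≤ P → Q = P)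
    {Q : TwoSidedIdeal R} (hQ : IsPrime Q) (hQ0 : Q ≠ ⊥) (hQP : Q < P) : False := by
  have hxQ : x ∉ Q := fun h => hQP.ne (hmin Q hQ h hQP.le)
  have hreg : ∀ r, r * x = 0 → r = 0 := fun r hr =>
    (TwoSidedIdeal.mem_bot R).1 (hR.mem_of_mul_normal hτ
      (fun h => hx0 ((TwoSidedIdeal.mem_bot R).1 h)) ((TwoSidedIdeal.mem_bot R).2 hr))
  have hpow : ∀ m, ∀ r, r * x ^ m = 0 → r = 0 := by
    intro m
    induction m with
    | zero => simp
    | succ m ih => exact fun r hr => ih r (hreg _ (by rwa [mul_assoc, ← pow_succ]))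
  have hpowQ : ∀ m, ∀ r, r * x ^ m ∈ Q → r ∈ Q := by
    intro m
    induction m with
    | zero => simp
    | succ m ih =>
      exact fun r hr => ih r (hQ.elemPrime.mem_of_mul_normal hτ hxQ (by rwa [mul_assoc, ← pow_succ]))
  have hσ : ∀ m, ∃ σ : R ≃+* R, (∀ a, x ^ m * a = σ a * x ^ m) ∧ ∀ r, r ∈ P ↔ σ r ∈ P := by
    intro m
    induction m with
    | zero => exact ⟨RingEquiv.refl R, by simp, by simp⟩
    | succ m ih =>
      obtain ⟨σ, h1, h2⟩ := ih
      refine ⟨τ.trans σ, fun a => ?_, fun r => (hτP r).trans (h2 _)⟩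
      rw [pow_succ, mul_assoc, hτ, ← mul_assoc, h1, mul_assoc]
      rfl
  have hinj : ∀ c : R, (∀ r, r * c = 0 → r = 0) → Function.Injective (mulRightHom c) := fun c hc =>
    (injective_iff_map_eq_zero _).2 fun r hr => hc r (by simpa using hr)
  have hfin : ∀ m, rk P (Ideal.span {x ^ m}) ⊤ ≠ ⊤ := by
    intro m
    induction m with
    | zero => simp [rk_self]
    | succ m ih =>
      have h1 : rk P (Ideal.span {x ^ (m + 1)}) (Ideal.span {x ^ m}) = rk P (Ideal.span {x}) ⊤ := by
        rw [← rk_map (B := ⊤) (hinj _ (hpow m)), map_mulRightHom_top, map_mulRightHom_span, pow_succ']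
      have h2 : Ideal.span {x ^ (m + 1)} ≤ Ideal.span {x ^ m} := by
        rw [Ideal.span_singleton_le_iff_mem, pow_succ']
        exact Ideal.mul_mem_left _ _ (Ideal.mem_span_singleton_self _)
      rw [← rk_add h2 le_top, h1]
      exact ENat.add_eq_top.not.2 (not_or.2 ⟨rk_span_singleton_ne_top hP hτ hmin, ih⟩)
  obtain ⟨c, hcQ, hc⟩ := hR.exists_regular hQ0
  set C : Ideal R := Ideal.span {c} with hC
  have hCQ : ∀ y ∈ C, y ∈ Q := fun y hy => by
    obtain ⟨a, rfl⟩ := Ideal.mem_span_singleton'.1 hy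
    exact Q.mul_mem_left _ _ hcQ
  -- Modulo `P x ^ m + C` the annihilator of `x ^ m` is exactly `P`: `(r - p) * x ^ m ∈ C ≤ Q` gives
  -- `r - p ∈ Q ≤ P`, because `x` is normal and not in `Q`.
  have hlower : ∀ m, HasChain P m (Ideal.span {x ^ m} ⊔ C) ⊤ := by
    intro m
    induction m with
    | zero => exact le_top
    | succ m ih =>
      rw [show m + 1 = 0 + 1 + m by omega]
      refine HasChain.trans (i := 0 + 1) ⟨_, le_rfl, ?_, ?_⟩ ih
      · refine sup_le_sup_right ?_ C
        rw [Ideal.span_singleton_le_iff_mem, show 0 + 1 + m = m + 1 by omega, pow_succ']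
        exact Ideal.mul_mem_left _ _ (Ideal.mem_span_singleton_self _)
      · refine ⟨Submodule.map (mulRightHom (x ^ m)) P.asIdeal ⊔ C, sup_le_sup_right ?_ C, x ^ m,
          Submodule.mem_sup_left (Ideal.mem_span_singleton_self _), 1,
          fun h => hP.1 ((TwoSidedIdeal.one_mem_iff P).1 h), fun r => ⟨fun h => ?_, fun h => ?_⟩⟩
        · rw [Ideal.span_singleton_le_iff_mem, show 0 + 1 + m = m + 1 by omega, pow_succ']
          exact ⟨x, hxP, by simp⟩
        · obtain ⟨_, ⟨p, hp, rfl⟩, d, hd, e⟩ := Submodule.mem_sup.1 h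
          have h1 : (r - p) * x ^ m = d := by
            rw [sub_mul, ← e]; simp
          have h2 : r - p ∈ P := hQP.le (hpowQ m _ (h1 ▸ hCQ d hd))
          simpa using P.add_mem h2 hp
        · rw [mul_one] at h
          exact Submodule.mem_sup_left ⟨r, h, by simp⟩
  let D : ℕ → Ideal R := fun m =>
    { carrier := {s | x ^ m * s ∈ C}
      zero_mem' := by simp
      add_mem' := fun {a b} ha hb => by
        change _ ∈ C
        rw [mul_add]; exact C.add_mem ha hb
      smul_mem' := fun a s hs => by
        obtain ⟨σ, h1, -⟩ := hσ m
        change _ ∈ C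
        rw [smul_eq_mul, ← mul_assoc, h1, mul_assoc]
        exact C.mul_mem_left _ hs }
  have hD : Monotone D := monotone_nat_of_le_succ fun m s (hs : x ^ m * s ∈ C) => by
    change _ ∈ C
    rw [pow_succ', mul_assoc]
    exact C.mul_mem_left _ hs
  -- Compare `X ≤ X ⊔ C ≤ R` with `R x ^ m c ≤ X ⊓ C ≤ C`. Right multiplication by `c` identifies `R
  -- / X` with `C / R x ^ m c`, so the total ranks agree, and the common finite rank of `C / (X ⊓
  -- C)` cancels. Cancelling `x ^ m` on the right and twisting by `σ`, which preserves `P`, turns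
  -- `(X ⊓ C) / R x ^ m c` into `D m / C`.
  have hrk : ∀ m, rk P (Ideal.span {x ^ m} ⊔ C) ⊤ = rk P C (D m) := by
    intro m
    obtain ⟨σ, h1, h2⟩ := hσ m
    set X : Ideal R := Ideal.span {x ^ m} with hX
    have e1 : rk P X (X ⊔ C) + rk P (X ⊔ C) ⊤ = rk P X ⊤ := rk_add le_sup_left le_top
    have hle : Ideal.span {x ^ m * c} ≤ X ⊓ C := by
      rw [Ideal.span_singleton_le_iff_mem]
      refine ⟨?_, C.mul_mem_left _ (Ideal.mem_span_singleton_self _)⟩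
      rw [h1]
      exact X.mul_mem_left _ (Ideal.mem_span_singleton_self _)
    have e2 : rk P (Ideal.span {x ^ m * c}) (X ⊓ C) + rk P (X ⊓ C) C = rk P X ⊤ := by
      rw [rk_add hle inf_le_right, ← rk_map (B := ⊤) (hinj c hc), map_mulRightHom_top,
        map_mulRightHom_span]
    have e3 : rk P (X ⊓ C) C = rk P X (X ⊔ C) := by rw [inf_comm, rk_inf_sup, sup_comm]
    have e4 : rk P (Ideal.span {x ^ m * c}) (X ⊓ C) = rk P C (D m) := by
      have hB : X ⊓ C = Submodule.map (mulRightHom (x ^ m))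
          (Submodule.comap (mulRightHom (x ^ m)) C) := by
        rw [Submodule.map_comap_eq, LinearMap.range_toSpanSingleton]
      rw [hB, h1, ← map_mulRightHom_span, rk_map (hinj _ (hpow m)),
        ← rk_comap_ringEquiv _ _ σ h2]
      congr 1
      · ext r
        rw [Ideal.mem_comap, Ideal.mem_span_singleton', Ideal.mem_span_singleton']
        exact ⟨fun ⟨a, ha⟩ => ⟨σ.symm a, σ.injective (by rw [map_mul, σ.apply_symm_apply, ha])⟩,
          fun ⟨a, ha⟩ => ⟨σ a, by rw [← ha, map_mul]⟩⟩
      · ext r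
        change σ r * x ^ m ∈ C ↔ x ^ m * r ∈ C
        rw [h1]
    have hf : rk P X (X ⊔ C) ≠ ⊤ := ne_top_of_le_ne_top (hfin m) (rk_mono le_rfl le_top)
    rw [← e2, e3, add_comm, e4] at e1
    exact ENat.add_left_injective_of_ne_top hf e1
  obtain ⟨s, hs⟩ := monotone_stabilizes_iff_noetherian.2 ‹IsNoetherianRing R› ⟨D, hD⟩
  have hne : rk P C (D s) ≠ ⊤ := by
    rw [← hrk]
    exact ne_top_of_le_ne_top (hfin s) (rk_mono le_sup_left le_rfl)
  refine hne (ENat.eq_top_iff_forall_ge.2 fun n => ?_)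
  calc (n : ℕ∞) ≤ ((s + n : ℕ) : ℕ∞) := by exact_mod_cast Nat.le_add_left n s
    _ ≤ _ := (hlower (s + n)).le_rk
    _ = rk P C (D (s + n)) := hrk _
    _ = rk P C (D s) := by rw [show D s = D (s + n) from hs _ (Nat.le_add_right _ _)]

end PrincipalIdealTheorem

/-! ### Irreducibility of the torus -/

section Torus

variable {K : Type*} [Field K] {r : ℕ}

/-- After multiplication with a monomial, a regular function becomes polynomial. -/
theorem IsRegularFunction.exists_mvPolynomial {φ : (Fin r → Kˣ) → K} (hφ : IsRegularFunction φ) :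
    ∃ (N : ℕ) (p : MvPolynomial (Fin r) K), ∀ t : Fin r → Kˣ,
      MvPolynomial.eval (fun i => (t i : K)) p = φ t * ∏ i, (t i : K) ^ N := by
  classical
  obtain ⟨c, hc⟩ := hφ
  obtain ⟨N, hN⟩ : ∃ N : ℕ, ∀ m ∈ c.support, ∀ i, 0 ≤ m i + N := by
    refine ⟨∑ m ∈ c.support, ∑ i, (m i).natAbs, fun m hm i => ?_⟩
    have h1 : (m i).natAbs ≤ ∑ i, (m i).natAbs :=
      Finset.single_le_sum (f := fun i => (m i).natAbs) (fun _ _ => Nat.zero_le _)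
        (Finset.mem_univ i)
    have h2 : ∑ i, (m i).natAbs ≤ ∑ m ∈ c.support, ∑ i, (m i).natAbs :=
      Finset.single_le_sum (f := fun m : Fin r → ℤ => ∑ i, (m i).natAbs)
        (fun _ _ => Nat.zero_le _) hm
    omega
  refine ⟨N, ∑ m ∈ c.support, MvPolynomial.C (c m) * ∏ i, MvPolynomial.X i ^ (m i + N).toNat,
    fun t => ?_⟩
  rw [hc, map_sum, Finsupp.sum, Finset.sum_mul]
  refine Finset.sum_congr rfl fun m hm => ?_
  rw [map_mul, map_prod, mul_assoc, ← Finset.prod_mul_distrib, MvPolynomial.eval_C]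
  congr 1
  refine Finset.prod_congr rfl fun i _ => ?_
  rw [map_pow, MvPolynomial.eval_X, Units.val_zpow_eq_zpow_val, ← zpow_natCast, ← zpow_natCast,
    ← zpow_add₀ (t i).ne_zero, Int.toNat_of_nonneg (hN m hm i)]

/-- The torus is irreducible: the product of two nonzero regular functions is nonzero. -/
theorem IsRegularFunction.eq_zero_or_eq_zero [Infinite K] {φ ψ : (Fin r → Kˣ) → K}
    (hφ : IsRegularFunction φ) (hψ : IsRegularFunction ψ) (h : ∀ t, φ t * ψ t = 0) :
    (∀ t, φ t = 0) ∨ ∀ t, ψ t = 0 := by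
  obtain ⟨N, p, hp⟩ := hφ.exists_mvPolynomial
  obtain ⟨M, q, hq⟩ := hψ.exists_mvPolynomial
  -- The product of the variables makes the polynomial vanish off the torus too; over an infinite
  -- field it is then zero.
  have hpq : p * q * ∏ i, MvPolynomial.X i = 0 := by
    refine MvPolynomial.funext fun x => ?_
    rw [map_mul, map_mul, map_prod, map_zero]
    by_cases hx : ∃ i, x i = 0
    · obtain ⟨i, hi⟩ := hx
      rw [Finset.prod_eq_zero (Finset.mem_univ i) (by rw [MvPolynomial.eval_X, hi]), mul_zero]
    · push Not at hx
      have h1 := hp fun i => Units.mk0 (x i) (hx i)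
      have h2 := hq fun i => Units.mk0 (x i) (hx i)
      simp only [Units.val_mk0] at h1 h2
      rw [h1, h2, mul_mul_mul_comm, h, zero_mul, zero_mul]
  have hX : ∏ i : Fin r, (MvPolynomial.X i : MvPolynomial (Fin r) K) ≠ 0 :=
    Finset.prod_ne_zero_iff.2 fun i _ => MvPolynomial.X_ne_zero i
  have aux : ∀ {χ : (Fin r → Kˣ) → K} {n : ℕ} {s : MvPolynomial (Fin r) K}, s = 0 →
      (∀ t : Fin r → Kˣ, MvPolynomial.eval (fun i => (t i : K)) s = χ t * ∏ i, (t i : K) ^ n) →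
      ∀ t, χ t = 0 := by
    intro χ n s hs H t
    have := H t
    rw [hs, map_zero, eq_comm] at this
    exact (mul_eq_zero.1 this).resolve_right
      (Finset.prod_ne_zero_iff.2 fun i _ => pow_ne_zero _ (t i).ne_zero)
  rcases mul_eq_zero.1 ((mul_eq_zero.1 hpq).resolve_right hX) with h0 | h0
  · exact Or.inl (aux h0 hp)
  · exact Or.inr (aux h0 hq)

variable {A : Type*} [Ring A] [Algebra K A]

theorem exists_dual_of_notMem {P : TwoSidedIdeal A} {a : A} (ha : a ∉ P) :
    ∃ f : Module.Dual K A, f a ≠ 0 ∧ ∀ x ∈ P, f x = 0 := by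
  let V : Submodule K A :=
    { carrier := P
      zero_mem' := P.zero_mem
      add_mem' := P.add_mem
      smul_mem' := fun k x hx => by
        rw [Algebra.smul_def]; exact P.mul_mem_left _ _ hx }
  obtain ⟨f, hf, hV⟩ := Submodule.exists_le_ker_of_notMem (p := V) (v := a) ha
  exact ⟨f, hf, fun x hx => hV hx⟩

variable {ρ : (Fin r → Kˣ) →* (A ≃ₐ[K] A)}

theorem IsRationalAction.isRegularFunction (hρ : IsRationalAction ρ) (a : A)
    (f : Module.Dual K A) : IsRegularFunction fun t => f (ρ t a) := by
  obtain ⟨V, ha, -, -, h⟩ := hρ a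
  exact h a ha f

/-- Functionals vanishing on `P` but not on two bad translates would give nonzero regular functions
with product zero. -/
theorem IsRationalAction.forall_mem_or_forall_mem [Infinite K] (hρ : IsRationalAction ρ)
    {P : TwoSidedIdeal A} {a b : A} (h : ∀ t, ρ t a ∈ P ∨ ρ t b ∈ P) :
    (∀ t, ρ t a ∈ P) ∨ ∀ t, ρ t b ∈ P := by
  by_contra! hcon
  obtain ⟨⟨s, hs⟩, t, ht⟩ := hcon
  obtain ⟨f, hf, hfP⟩ := exists_dual_of_notMem (K := K) hs
  obtain ⟨g, hg, hgP⟩ := exists_dual_of_notMem (K := K) ht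
  rcases (hρ.isRegularFunction a f).eq_zero_or_eq_zero (hρ.isRegularFunction b g) (fun u => by
    rcases h u with h | h
    · rw [hfP _ h, zero_mul]
    · rw [hgP _ h, mul_zero]) with h | h
  · exact hf (h s)
  · exact hg (h t)

end Torus

/-! ### Invariant cores of ideals -/

section Invariant

variable {K A G : Type*} [Field K] [Ring A] [Algebra K A] [Group G] (ρ : G →* (A ≃ₐ[K] A))

/-- The largest invariant ideal contained in `P`. -/
def invariantCore (P : TwoSidedIdeal A) : TwoSidedIdeal A :=
  .mk' {a | ∀ g, ρ g a ∈ P} (fun g => by simp)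
    (fun ha hb g => by rw [map_add]; exact P.add_mem (ha g) (hb g))
    (fun ha g => by rw [map_neg]; exact P.neg_mem (ha g))
    (fun hb g => by rw [map_mul]; exact P.mul_mem_left _ _ (hb g))
    (fun ha g => by rw [map_mul]; exact P.mul_mem_right _ _ (ha g))

variable {ρ} {P : TwoSidedIdeal A}

theorem mem_invariantCore {a : A} : a ∈ invariantCore ρ P ↔ ∀ g, ρ g a ∈ P :=
  TwoSidedIdeal.mem_mk' ..

theorem invariantCore_le : invariantCore ρ P ≤ P := fun a ha => by
  simpa using mem_invariantCore.1 ha 1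

theorem isInvariant_invariantCore : IsInvariant ρ (invariantCore ρ P) := fun g a ha => by
  rw [mem_invariantCore] at ha ⊢
  intro h
  simpa using ha (h * g)

theorem IsInvariant.le_invariantCore {L : TwoSidedIdeal A} (hL : IsInvariant ρ L) (h : L ≤ P) :
    L ≤ invariantCore ρ P := fun a ha => mem_invariantCore.2 fun g => h (hL g a ha)

theorem IsInvariant.mem_iff (hP : IsInvariant ρ P) (g : G) (a : A) : a ∈ P ↔ ρ g a ∈ P :=
  ⟨hP g a, fun h => by simpa [← AlgEquiv.mul_apply, ← map_mul] using hP g⁻¹ _ h⟩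

theorem IsPrime.isGPrime (hP : IsPrime P) (h : IsInvariant ρ P) : IsGPrime ρ P :=
  ⟨h, hP.1, fun J L _ _ => hP.2 J L⟩

/-- Take `P` maximal with core `I`. If `J * L ⊆ P` with neither factor in `P`, the cores of `P ⊔ J`
and `P ⊔ L` are not in `I`, but their product is, contradicting `G`-primeness. -/
theorem IsGPrime.exists_isPrime [IsNoetherianRing A] {I : TwoSidedIdeal A} (hI : IsGPrime ρ I) :
    ∃ P, IsPrime P ∧ invariantCore ρ P = I := by
  have := wellFoundedGT_twoSidedIdeal (R := A)
  have hcore : invariantCore ρ I = I := le_antisymm invariantCore_le (hI.1.le_invariantCore le_rfl)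
  obtain ⟨P, hP, hmax⟩ := wellFounded_gt.has_min
    {P : TwoSidedIdeal A | invariantCore ρ P = I} ⟨I, hcore⟩
  refine ⟨P, ⟨?_, fun J L hJL => ?_⟩, hP⟩
  · rintro rfl
    refine hI.2.1 (top_le_iff.1 ?_)
    rw [← hP]
    exact fun a _ => mem_invariantCore.2 fun _ => trivial
  by_contra! hcon
  have key : ∀ J, ¬ J ≤ P → ¬ invariantCore ρ (P ⊔ J) ≤ I := fun J hJ h => by
    refine hmax (P ⊔ J) (le_antisymm h ?_) (left_lt_sup.2 hJ)
    exact hI.1.le_invariantCore (hP ▸ invariantCore_le.trans le_sup_left)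
  refine (hI.2.2 _ _ isInvariant_invariantCore isInvariant_invariantCore ?_).elim
    (key J hcon.1) (key L hcon.2)
  intro a ha b hb
  rw [← hP]
  rw [mem_invariantCore] at ha hb ⊢
  intro g
  obtain ⟨p, hp, x, hx, e⟩ := TwoSidedIdeal.mem_sup.1 (ha g)
  obtain ⟨q, hq, y, hy, e'⟩ := TwoSidedIdeal.mem_sup.1 (hb g)
  rw [map_mul, ← e, ← e', add_mul, mul_add x]
  exact P.add_mem (P.mul_mem_right _ _ hp) (P.add_mem (P.mul_mem_left _ _ hq) (hJL x hx y hy))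

end Invariant

/-! ### Torus-primes are prime -/

section TorusPrime

variable {K A : Type*} [Field K] [Infinite K] [Ring A] [Algebra K A] {r : ℕ}
  {ρ : (Fin r → Kˣ) →* (A ≃ₐ[K] A)}

theorem IsRationalAction.isPrime_invariantCore (hρ : IsRationalAction ρ) {P : TwoSidedIdeal A}
    (hP : IsPrime P) : IsPrime (invariantCore ρ P) := by
  refine ElemPrime.isPrime (fun a b hab => ?_) fun h =>
    hP.1 (top_le_iff.1 (h ▸ invariantCore_le))
  rw [mem_invariantCore, mem_invariantCore]
  refine hρ.forall_mem_or_forall_mem fun t => hP.elemPrime _ _ fun x => ?_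
  have := mem_invariantCore.1 (hab ((ρ t).symm x)) t
  simpa using this

theorem IsRationalAction.isPrime_of_isGPrime [IsNoetherianRing A] (hρ : IsRationalAction ρ)
    {I : TwoSidedIdeal A} (hI : IsGPrime ρ I) : IsPrime I := by
  obtain ⟨P, hP, rfl⟩ := hI.exists_isPrime
  exact hρ.isPrime_invariantCore hP

end TorusPrime

/-! ### Minimal primes over an ideal and an element -/

section Minimal

variable {A : Type*} [Ring A]

theorem isPrime_sInf_of_isChain {c : Set (TwoSidedIdeal A)} (hc : IsChain (· ≤ ·) c)
    (hne : c.Nonempty) (hprime : ∀ P ∈ c, IsPrime P) : IsPrime (sInf c) := by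
  obtain ⟨y, hy⟩ := hne
  refine ElemPrime.isPrime (fun a b hab => ?_) fun h =>
    (hprime y hy).1 (top_le_iff.1 (h ▸ sInf_le hy))
  by_contra! hcon
  rw [TwoSidedIdeal.mem_sInf, TwoSidedIdeal.mem_sInf] at hcon
  push Not at hcon
  obtain ⟨⟨P₁, h₁, ha⟩, P₂, h₂, hb⟩ := hcon
  have key : ∀ P ∈ c, P ≤ P₁ → P ≤ P₂ → False := fun P hP hP₁ hP₂ =>
    ((hprime P hP).elemPrime a b fun r => (TwoSidedIdeal.mem_sInf A).1 (hab r) P hP).elim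
      (fun h => ha (hP₁ h)) (fun h => hb (hP₂ h))
  rcases hc.total h₁ h₂ with h | h
  · exact key P₁ h₁ le_rfl h
  · exact key P₂ h₂ h le_rfl

theorem IsPrime.exists_minimal_le {I' I : TwoSidedIdeal A} {u : A} (hI' : IsPrime I')
    (hI : I ≤ I') (hu : u ∈ I') :
    ∃ P, IsPrime P ∧ I ≤ P ∧ u ∈ P ∧ P ≤ I' ∧
      ∀ Q, IsPrime Q → I ≤ Q → u ∈ Q → Q ≤ P → Q = P := by
  let S : Set (TwoSidedIdeal A) := {P | IsPrime P ∧ I ≤ P ∧ u ∈ P}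
  have hS : ∀ c ⊆ S, IsChain (· ≤ ·) c → ∀ y ∈ c, ∃ lb ∈ S, ∀ z ∈ c, lb ≤ z := fun c hcS hc y hy =>
    ⟨sInf c, ⟨isPrime_sInf_of_isChain hc ⟨y, hy⟩ fun P hP => (hcS hP).1,
      le_sInf fun P hP => (hcS hP).2.1, (TwoSidedIdeal.mem_sInf A).2 fun P hP => (hcS hP).2.2⟩,
      fun z hz => sInf_le hz⟩
  obtain ⟨P, hPI, ⟨hP, hIP, huP⟩, hmin⟩ := @zorn_le_nonempty₀ (TwoSidedIdeal A)ᵒᵈ _ S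
    (fun c hcS hc => hS c hcS hc.symm) I' ⟨hI', hI, hu⟩
  exact ⟨P, hP, hIP, huP, hPI, fun Q hQ hIQ huQ h => le_antisymm h (hmin ⟨hQ, hIQ, huQ⟩ h)⟩

end Minimal

/-! ### Transfer of primes along surjections -/

section Quotient

variable {A B : Type*} [Ring A] [Ring B] {f : A →+* B}

theorem exists_twoSidedIdeal_map (hf : Function.Surjective f) {P : TwoSidedIdeal A}
    (hP : ∀ a, f a = 0 → a ∈ P) :
    ∃ P' : TwoSidedIdeal B, ∀ a, f a ∈ P' ↔ a ∈ P := by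
  refine ⟨.mk' (f '' P) ⟨0, P.zero_mem, map_zero f⟩ ?_ ?_ ?_ ?_, fun a => ?_⟩
  · rintro _ _ ⟨a, ha, rfl⟩ ⟨b, hb, rfl⟩
    exact ⟨a + b, P.add_mem ha hb, map_add f a b⟩
  · rintro _ ⟨a, ha, rfl⟩
    exact ⟨-a, P.neg_mem ha, map_neg f a⟩
  · rintro x _ ⟨b, hb, rfl⟩
    obtain ⟨a, rfl⟩ := hf x
    exact ⟨a * b, P.mul_mem_left _ _ hb, map_mul f a b⟩
  · rintro _ y ⟨a, ha, rfl⟩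
    obtain ⟨b, rfl⟩ := hf y
    exact ⟨a * b, P.mul_mem_right _ _ ha, map_mul f a b⟩
  · refine (TwoSidedIdeal.mem_mk' ..).trans ⟨fun ⟨b, hb, e⟩ => ?_, fun h => ⟨a, h, rfl⟩⟩
    have := P.add_mem (hP (a - b) (by rw [map_sub, e, sub_self])) hb
    simpa using this

theorem isPrime_iff_of_surjective (hf : Function.Surjective f) {P : TwoSidedIdeal A}
    {P' : TwoSidedIdeal B} (h : ∀ a, f a ∈ P' ↔ a ∈ P) : IsPrime P' ↔ IsPrime P := by
  have htop : P' = ⊤ ↔ P = ⊤ := by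
    rw [← TwoSidedIdeal.one_mem_iff, ← TwoSidedIdeal.one_mem_iff, ← h, map_one]
  refine ⟨fun hP => ElemPrime.isPrime (fun a b hab => ?_) (htop.not.1 hP.1),
    fun hP => ElemPrime.isPrime (fun x y hxy => ?_) (htop.not.2 hP.1)⟩
  · rw [← h, ← h]
    refine hP.elemPrime _ _ fun r => ?_
    obtain ⟨r, rfl⟩ := hf r
    rw [← map_mul, ← map_mul, h]
    exact hab r
  · obtain ⟨a, rfl⟩ := hf x
    obtain ⟨b, rfl⟩ := hf y
    rw [h, h]
    refine hP.elemPrime _ _ fun r => ?_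
    rw [← h, map_mul, map_mul]
    exact hxy _

end Quotient

/-- The principal ideal theorem for an element `u` that is normal modulo a prime `I`. -/
theorem principal_ideal_theorem_mod {A : Type*} [Ring A] [IsNoetherianRing A]
    {I P Q : TwoSidedIdeal A} (hI : IsPrime I) (hP : IsPrime P) {u : A} (huI : u ∉ I)
    (huP : u ∈ P) (hIP : I ≤ P) {σ : A ≃+* A} (hσI : ∀ a, a ∈ I ↔ σ a ∈ I)
    (hσP : ∀ a, a ∈ P ↔ σ a ∈ P) (hu : ∀ a, u * a - σ a * u ∈ I)
    (hmin : ∀ Q, IsPrime Q → I ≤ Q → u ∈ Q → Q ≤ P → Q = P)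
    (hQ : IsPrime Q) (hIQ : I < Q) (hQP : Q < P) : False := by
  let f := Ideal.Quotient.mk I.asIdeal
  have hf : Function.Surjective f := Ideal.Quotient.mk_surjective
  have hf0 : ∀ a, f a = 0 ↔ a ∈ I := fun a => Ideal.Quotient.eq_zero_iff_mem
  have hbot : ∀ a, f a ∈ (⊥ : TwoSidedIdeal (A ⧸ I.asIdeal)) ↔ a ∈ I := fun a => by
    rw [TwoSidedIdeal.mem_bot, hf0]
  have : IsNoetherianRing (A ⧸ I.asIdeal) := isNoetherianRing_of_surjective A _ f hf
  obtain ⟨P', hP'⟩ := exists_twoSidedIdeal_map hf fun a h => hIP ((hf0 a).1 h)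
  obtain ⟨Q', hQ'⟩ := exists_twoSidedIdeal_map hf fun a h => hIQ.le ((hf0 a).1 h)
  have hmap : I.asIdeal = Ideal.map (σ : A →+* A) I.asIdeal := by
    refine le_antisymm (fun a ha => ?_) (Ideal.map_le_iff_le_comap.2 fun a ha => (hσI a).1 ha)
    have h1 : σ.symm a ∈ I := by rwa [hσI, σ.apply_symm_apply]
    simpa using Ideal.mem_map_of_mem (σ : A →+* A) (show σ.symm a ∈ I.asIdeal from h1)
  let τ := Ideal.quotientEquiv I.asIdeal I.asIdeal σ hmap
  have hτf : ∀ a, τ (f a) = f (σ a) := fun a => rfl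
  refine principal_ideal_theorem (P := P') (x := f u) (τ := τ) (Q := Q')
    ((isPrime_iff_of_surjective hf hbot).2 hI).elemPrime
    ((isPrime_iff_of_surjective hf hP').2 hP) (fun h => huI ((hf0 u).1 h)) ((hP' u).2 huP)
    (fun y => ?_) (fun y => ?_) (fun S hS hxS hSP => ?_)
    ((isPrime_iff_of_surjective hf hQ').2 hQ) (fun h => ?_) ?_
  · obtain ⟨a, rfl⟩ := hf y
    rw [hτf, ← map_mul, ← map_mul, ← sub_eq_zero, ← map_sub, hf0]
    exact hu a
  · obtain ⟨a, rfl⟩ := hf y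
    rw [hτf, hP', hP', hσP]
  · have h1 := hmin (S.comap f)
      ((isPrime_iff_of_surjective hf fun a => (TwoSidedIdeal.mem_comap f).symm).1 hS)
      (fun a ha => (TwoSidedIdeal.mem_comap f).2 (by rw [(hf0 a).2 ha]; exact S.zero_mem))
      ((TwoSidedIdeal.mem_comap f).2 hxS)
      (fun a ha => (hP' a).1 (hSP ((TwoSidedIdeal.mem_comap f).1 ha)))
    refine TwoSidedIdeal.ext fun y => ?_
    obtain ⟨a, rfl⟩ := hf y
    rw [hP', ← h1, TwoSidedIdeal.mem_comap]
  · exact not_le_of_gt hIQ fun a ha => (hbot a).1 (h ▸ (hQ' a).2 ha)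
  · refine lt_of_le_not_ge (fun y hy => ?_) fun h => not_le_of_gt hQP fun a ha =>
      (hQ' a).1 (h ((hP' a).2 ha))
    obtain ⟨a, rfl⟩ := hf y
    exact (hP' a).2 (hQP.le ((hQ' a).1 hy))

/-! ### Construction of the saturated chain -/

section Chain

variable {K A : Type*} [Field K] [Infinite K] [Ring A] [Algebra K A] [IsNoetherianRing A] {r : ℕ}
  {ρ : (Fin r → Kˣ) →* (A ≃ₐ[K] A)}

/-- Above a torus-prime ideal `I` and below `I'` there is an invariant prime of height one
over `I`. -/
theorem IsGNormallySeparated.exists_cover (hρ : IsRationalAction ρ)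
    (hsep : IsGNormallySeparated ρ) {I I' : TwoSidedIdeal A} (hI : IsGPrime ρ I)
    (hI' : IsGPrime ρ I') (hlt : I < I') :
    ∃ P, IsPrime P ∧ IsInvariant ρ P ∧ I < P ∧ P ≤ I' ∧
      ¬ ∃ Q : TwoSidedIdeal A, IsPrime Q ∧ I < Q ∧ Q < P := by
  obtain ⟨u, huI', huI, ⟨χ, hχ⟩, g, hg⟩ := hsep I I' hI hI' hlt
  obtain ⟨P, hP, hIP, huP, hPI', hmin⟩ :=
    (hρ.isPrime_of_isGPrime hI').exists_minimal_le hlt.le huI'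
  -- The core contains `u` because every translate of `u` is a multiple of `u` modulo `I ≤ P`.
  have hcore : invariantCore ρ P = P := by
    refine hmin _ (hρ.isPrime_invariantCore hP) (hI.1.le_invariantCore hIP)
      (mem_invariantCore.2 fun t => ?_) invariantCore_le
    have h1 : χ t • u ∈ P := by rw [Algebra.smul_def]; exact P.mul_mem_left _ _ huP
    simpa using P.add_mem (hIP (hχ t)) h1
  have hinv : IsInvariant ρ P := hcore ▸ isInvariant_invariantCore
  refine ⟨P, hP, hinv, lt_of_le_of_ne hIP fun h => huI (h ▸ huP), hPI', ?_⟩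
  rintro ⟨Q, hQ, hIQ, hQP⟩
  exact principal_ideal_theorem_mod (σ := (ρ g : A ≃+* A)) (hρ.isPrime_of_isGPrime hI) hP huI huP
    hIP (hI.1.mem_iff g) (hinv.mem_iff g) hg hmin hQ hIQ hQP

theorem IsGNormallySeparated.exists_chain (hρ : IsRationalAction ρ)
    (hsep : IsGNormallySeparated ρ) {I' : TwoSidedIdeal A} (hI' : IsGPrime ρ I')
    (I : TwoSidedIdeal A) (hI : IsGPrime ρ I) (hle : I ≤ I') :
    ∃ (n : ℕ) (P : Fin (n + 1) → TwoSidedIdeal A),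
      P 0 = I ∧ P (Fin.last n) = I' ∧ (∀ i, IsPrime (P i) ∧ IsInvariant ρ (P i)) ∧
      ∀ i : Fin n, P i.castSucc < P i.succ ∧
        ¬ ∃ Q : TwoSidedIdeal A, IsPrime Q ∧ P i.castSucc < Q ∧ Q < P i.succ := by
  have := wellFoundedGT_twoSidedIdeal (R := A)
  induction I using WellFoundedGT.induction with
  | ind I ih =>
  have hIprime := hρ.isPrime_of_isGPrime hI
  rcases hle.eq_or_lt with rfl | hlt
  · exact ⟨0, fun _ => I, rfl, rfl, fun _ => ⟨hIprime, hI.1⟩, fun i => i.elim0⟩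
  obtain ⟨J, hJ, hJinv, hIJ, hJI', hcov⟩ := hsep.exists_cover hρ hI hI' hlt
  obtain ⟨n, P, h0, hlast, hP, hstep⟩ := ih J hIJ (hJ.isGPrime hJinv) hJI'
  refine ⟨n + 1, Fin.cons I P, rfl, ?_, fun i => ?_, fun i => ?_⟩
  · rw [← Fin.succ_last, Fin.cons_succ, hlast]
  · refine Fin.cases ?_ (fun i => ?_) i
    · exact ⟨hIprime, hI.1⟩
    · exact hP i
  · refine Fin.cases ?_ (fun i => ?_) i
    · rw [Fin.castSucc_zero, Fin.cons_zero, Fin.cons_succ, h0]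
      exact ⟨hIJ, hcov⟩
    · rw [Fin.castSucc_succ, Fin.cons_succ, Fin.cons_succ]
      exact hstep i

end Chain

end TorusSpec

theorem proposition5p9 {K A : Type*} [Field K] [Infinite K] [Ring A] [Algebra K A]
    (hleft : IsNoetherianRing A) (hright : IsNoetherianRing Aᵐᵒᵖ)
    {r : ℕ} (ρ : (Fin r → Kˣ) →* (A ≃ₐ[K] A)) (hρ : TorusSpec.IsRationalAction ρ)
    (hsep : TorusSpec.IsGNormallySeparated ρ)
    (I I' : TwoSidedIdeal A) (hI : TorusSpec.IsGPrime ρ I) (hI' : TorusSpec.IsGPrime ρ I')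
    (hlt : I < I') :
    ∃ (n : ℕ) (P : Fin (n + 1) → TwoSidedIdeal A),
      P 0 = I ∧ P (Fin.last n) = I' ∧
      (∀ i, TorusSpec.IsPrime (P i) ∧ TorusSpec.IsInvariant ρ (P i)) ∧
      ∀ i : Fin n, P i.castSucc < P i.succ ∧
        ¬ ∃ Q : TwoSidedIdeal A, TorusSpec.IsPrime Q ∧ P i.castSucc < Q ∧ Q < P i.succ :=
  hsep.exists_chain hρ hI' I hI hlt.le
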